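/- For $a,q\in\mathbb{C}$ with $|q|<1$ let $(a;q)_\infty=\prod_{k=0}^{\infty}(1-aq^k)$ and let $\chi(q)=(-q;q^2)_\infty$. For a positive rational number $n$, the class invariant $G_n$ is defined by $$G_n=2^{-1/4}q^{-1/24}\chi(q),\qquad q=e^{-\pi\sqrt n}.$$ Then $$G_{125}=\frac12\left(\frac{11+5\sqrt5}{2}\right)^{1/4}\left(\frac{1}{\sqrt5}\left\{1+\left(\frac{2(1+\tan\frac{\pi}{5})}{1-\sin\frac{\pi}{5}}\right)^{1/5}+\left(\frac{2(1-\tan\frac{\pi}{5})}{1+\sin\frac{\pi}{5}}\right)^{1/5}\right\}^2-1\right),$$ where all roots are the positive real roots of positive real numbers. -/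

import Mathlib

noncomputable section

/-- The infinite `q`-shifted factorial `(a; q)_∞ = ∏_{k ≥ 0} (1 - a q^k)`, for `|q| < 1`. -/
def qPochhammerInf {𝕜 : Type*} [NormedField 𝕜] (a q : 𝕜) : 𝕜 :=
  ∏' k : ℕ, (1 - a * q ^ k)

/-- The product defining `(a; q)_∞` converges (unconditionally) whenever `|q| < 1`. -/
theorem multipliable_qPochhammerInf {𝕜 : Type*} [NormedField 𝕜] [CompleteSpace 𝕜]
    (a q : 𝕜) (hq : ‖q‖ < 1) : Multipliable fun k : ℕ => 1 - a * q ^ k := by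
  have h : Summable fun k : ℕ => ‖-(a * q ^ k)‖ := by
    simpa [norm_mul, norm_pow] using
      (summable_geometric_of_lt_one (norm_nonneg q) hq).mul_left ‖a‖
  simpa [sub_eq_add_neg] using multipliable_one_add_of_summable h

/-- Ramanujan's function `χ(q) = (-q; q²)_∞`. -/
def ramanujanChi {𝕜 : Type*} [NormedField 𝕜] (q : 𝕜) : 𝕜 :=
  qPochhammerInf (-q) (q ^ 2)

/-- The class invariant `G_n = 2^{-1/4} q^{-1/24} χ(q)` with `q = e^{-π √n}`,
for a positive rational number `n`. All powers are real powers of positive reals. -/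
def classInvariantG (n : ℚ) : ℝ :=
  (2 : ℝ) ^ (-(1 / 4) : ℝ) *
    Real.exp (-Real.pi * Real.sqrt (n : ℝ)) ^ (-(1 / 24) : ℝ) *
    ramanujanChi (Real.exp (-Real.pi * Real.sqrt (n : ℝ)))

end

noncomputable section

open Filter Topology

/-! ### Finite and infinite `q`-products -/

/-! Write 𝔣 for the Weber function on the imaginary axis, so that `G_n = 2^{-1/4} 𝔣(i√n)`, and put
`u = 𝔣(i√5)`, `v = 𝔣(5i√5)`. The value of `v` comes from `u` through a modular equation of degree
five.

The source of that equation is a relation between `ϑ₃(it)²` and `ϑ₃(5it)²` (`thetaThree_sq_sub`):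
split the norm form `a² + b²` over the cosets of `(2 + i)` in `ℤ[i]`, then turn the resulting theta
series into products by Jacobi's identity. The inversion `t ↦ 1/(5t)` gives a dual relation, and
eliminating the eta quotient between the two leaves `u⁵v⁵ = u⁶ + v⁶ + 4uv`
(`weberF_modular_equation`). At the fixed point `t = 1/√5` of the inversion the same relation gives
`u⁴ = √5 + 1`.

Hence `w = v/u` satisfies a sextic over `ℚ(√5)`. It has the spurious root 1, and the remaining
quintic has a single positive root. That root is solvable: with `AB = √5 - 1` and `A⁵ + B⁵ = 20√5 -
36` it is quadratic in `1 + A + B` (`quintic_radical_root`), and the two radicands of the theorem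
have exactly this product and sum of fifth powers. -/

/-- The finite product `(Q; Q)_n`. -/
def qFactorial (Q : ℝ) (n : ℕ) : ℝ := ∏ k ∈ Finset.range n, (1 - Q * Q ^ k)

lemma qFactorial_succ (Q : ℝ) (n : ℕ) :
    qFactorial Q (n + 1) = qFactorial Q n * (1 - Q ^ (n + 1)) := by
  rw [qFactorial, Finset.prod_range_succ, pow_succ', qFactorial]

lemma qFactorial_pos {Q : ℝ} (h0 : 0 ≤ Q) (h1 : Q < 1) (n : ℕ) : 0 < qFactorial Q n := by
  refine Finset.prod_pos fun k _ => ?_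
  rw [← pow_succ', sub_pos]
  exact pow_lt_one₀ h0 h1 (Nat.succ_ne_zero k)

lemma qFactorial_antitone {Q : ℝ} (h0 : 0 ≤ Q) (h1 : Q < 1) : Antitone (qFactorial Q) := by
  refine antitone_nat_of_succ_le fun n => ?_
  rw [qFactorial_succ]
  have := pow_nonneg h0 (n + 1)
  exact mul_le_of_le_one_right (qFactorial_pos h0 h1 n).le (by linarith)

lemma norm_lt_one_of_mem {Q : ℝ} (h0 : 0 ≤ Q) (h1 : Q < 1) : ‖Q‖ < 1 := by
  rwa [Real.norm_of_nonneg h0]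

lemma tendsto_prod_qPochhammerInf (a : ℝ) {Q : ℝ} (h0 : 0 ≤ Q) (h1 : Q < 1) :
    Tendsto (fun n => ∏ k ∈ Finset.range n, (1 - a * Q ^ k)) atTop (𝓝 (qPochhammerInf a Q)) :=
  (multipliable_qPochhammerInf a Q (norm_lt_one_of_mem h0 h1)).hasProd.tendsto_prod_nat

lemma qPochhammerInf_ne_zero {a Q : ℝ} (h0 : 0 ≤ Q) (h1 : Q < 1) (h : ∀ k : ℕ, 0 < 1 - a * Q ^ k) :
    qPochhammerInf a Q ≠ 0 := by
  have := tprod_one_add_ne_zero_of_summable (f := fun k : ℕ => -(a * Q ^ k))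
    (fun i => by simpa [sub_eq_add_neg] using (h i).ne')
    (by simpa [norm_mul, norm_pow] using
      (summable_geometric_of_lt_one (norm_nonneg Q) (norm_lt_one_of_mem h0 h1)).mul_left ‖a‖)
  simpa [qPochhammerInf, sub_eq_add_neg] using this

lemma qPochhammerInf_pos {a Q : ℝ} (h0 : 0 ≤ Q) (h1 : Q < 1) (h : ∀ k : ℕ, 0 < 1 - a * Q ^ k) :
    0 < qPochhammerInf a Q :=
  lt_of_le_of_ne (ge_of_tendsto' (tendsto_prod_qPochhammerInf a h0 h1)
    fun _ => Finset.prod_nonneg fun k _ => (h k).le) (qPochhammerInf_ne_zero h0 h1 h).symm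

lemma qPochhammerInf_self_pos {Q : ℝ} (h0 : 0 ≤ Q) (h1 : Q < 1) : 0 < qPochhammerInf Q Q :=
  qPochhammerInf_pos h0 h1 fun k => by
    rw [← pow_succ', sub_pos]
    exact pow_lt_one₀ h0 h1 (Nat.succ_ne_zero k)

lemma one_le_qPochhammerInf_neg {a Q : ℝ} (ha : 0 ≤ a) (h0 : 0 ≤ Q) (h1 : Q < 1) :
    1 ≤ qPochhammerInf (-a) Q :=
  ge_of_tendsto' (tendsto_prod_qPochhammerInf (-a) h0 h1) fun _ =>
    Finset.prod_induction _ (1 ≤ ·) (fun _ _ => one_le_mul_of_one_le_of_one_le) le_rfl fun k _ => by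
      have := mul_nonneg ha (pow_nonneg h0 k)
      linarith

lemma qPochhammerInf_self_le_qFactorial {Q : ℝ} (h0 : 0 ≤ Q) (h1 : Q < 1) (n : ℕ) :
    qPochhammerInf Q Q ≤ qFactorial Q n :=
  (qFactorial_antitone h0 h1).le_of_tendsto (tendsto_prod_qPochhammerInf Q h0 h1) n

/-- Splitting `(a; Q)_∞` according to the residue of the index modulo `5`. -/
lemma qPochhammerInf_eq_prod_five (a : ℝ) {Q : ℝ} (h0 : 0 ≤ Q) (h1 : Q < 1) :
    qPochhammerInf a Q = qPochhammerInf a (Q ^ 5) * qPochhammerInf (a * Q) (Q ^ 5) *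
      qPochhammerInf (a * Q ^ 2) (Q ^ 5) * qPochhammerInf (a * Q ^ 3) (Q ^ 5) *
      qPochhammerInf (a * Q ^ 4) (Q ^ 5) := by
  have h0' : 0 ≤ Q ^ 5 := pow_nonneg h0 5
  have h1' : Q ^ 5 < 1 := pow_lt_one₀ h0 h1 (by norm_num)
  have hL := (tendsto_prod_qPochhammerInf a h0 h1).comp
    (tendsto_id.const_mul_atTop' (by norm_num : (0 : ℕ) < 5))
  have hR := ((((tendsto_prod_qPochhammerInf a h0' h1').mul
    (tendsto_prod_qPochhammerInf (a * Q) h0' h1')).mul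
    (tendsto_prod_qPochhammerInf (a * Q ^ 2) h0' h1')).mul
    (tendsto_prod_qPochhammerInf (a * Q ^ 3) h0' h1')).mul
    (tendsto_prod_qPochhammerInf (a * Q ^ 4) h0' h1')
  refine tendsto_nhds_unique hL (hR.congr fun n => ?_)
  simp only [Function.comp, id]
  induction n with
  | zero => simp
  | succ n ih =>
    rw [show 5 * (n + 1) = 5 * n + 1 + 1 + 1 + 1 + 1 by ring]
    simp only [Finset.prod_range_succ, ← ih]
    ring

/-! ### The Jacobi triple product -/

/-- Gaussian binomial coefficients. -/
def gaussBinom (Q : ℝ) : ℕ → ℕ → ℝ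
  | _, 0 => 1
  | 0, _ + 1 => 0
  | n + 1, k + 1 => gaussBinom Q n k + Q ^ (k + 1) * gaussBinom Q n (k + 1)

lemma gaussBinom_zero_right (Q : ℝ) (n : ℕ) : gaussBinom Q n 0 = 1 := by
  cases n <;> rfl

lemma gaussBinom_succ_succ (Q : ℝ) (n k : ℕ) :
    gaussBinom Q (n + 1) (k + 1) = gaussBinom Q n k + Q ^ (k + 1) * gaussBinom Q n (k + 1) := rfl

lemma gaussBinom_eq_zero_of_lt (Q : ℝ) {n k : ℕ} (h : n < k) : gaussBinom Q n k = 0 := by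
  induction n generalizing k with
  | zero => obtain ⟨k, rfl⟩ := Nat.exists_eq_succ_of_ne_zero h.ne'; rfl
  | succ n ih =>
    obtain ⟨k, rfl⟩ := Nat.exists_eq_succ_of_ne_zero (Nat.ne_zero_of_lt h)
    rw [Nat.succ_eq_add_one, gaussBinom_succ_succ, ih (by omega), ih (by omega)]
    ring

lemma gaussBinom_self (Q : ℝ) (n : ℕ) : gaussBinom Q n n = 1 := by
  induction n with
  | zero => rfl
  | succ n ih => rw [gaussBinom_succ_succ, ih, gaussBinom_eq_zero_of_lt Q (Nat.lt_succ_self n)]; ring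

lemma gaussBinom_nonneg {Q : ℝ} (h0 : 0 ≤ Q) (n k : ℕ) : 0 ≤ gaussBinom Q n k := by
  induction n generalizing k with
  | zero => cases k <;> simp [gaussBinom]
  | succ n ih =>
    cases k with
    | zero => simp [gaussBinom]
    | succ k => exact add_nonneg (ih k) (mul_nonneg (pow_nonneg h0 _) (ih _))

/-- Pascal's rule combined with `1 - Q^{i+j+2} = (1 - Q^{i+1}) + Q^{i+1}(1 - Q^{j+1})`. The
symmetric form in `i + j = n` avoids division and truncated subtraction. -/
lemma gaussBinom_mul_qFactorial (Q : ℝ) (n : ℕ) : ∀ i j : ℕ, i + j = n →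
    gaussBinom Q n i * qFactorial Q i * qFactorial Q j = qFactorial Q n := by
  induction n with
  | zero =>
    intro i j h
    obtain ⟨rfl, rfl⟩ : i = 0 ∧ j = 0 := by omega
    simp [gaussBinom, qFactorial]
  | succ n ih =>
    intro i j h
    rcases i with _ | i
    · obtain rfl : j = n + 1 := by omega
      simp [gaussBinom, qFactorial]
    rcases j with _ | j
    · obtain rfl : i = n := by omega
      rw [gaussBinom_self]
      simp [qFactorial]
    have e1 := ih i (j + 1) (by omega)
    have e2 := ih (i + 1) j (by omega)
    rw [gaussBinom_succ_succ, qFactorial_succ Q n]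
    have e3 : Q ^ (n + 1) = Q ^ (i + 1) * Q ^ (j + 1) := by rw [← pow_add]; congr 1; omega
    rw [qFactorial_succ Q j] at *
    rw [qFactorial_succ Q i] at *
    rw [e3]
    linear_combination (1 - Q ^ (i + 1)) * e1 + Q ^ (i + 1) * (1 - Q ^ (j + 1)) * e2

/-- The `q`-binomial theorem. -/
lemma prod_one_add_mul_pow (q : ℝ) (M : ℕ) : ∀ z : ℝ,
    ∏ k ∈ Finset.range M, (1 + z * q ^ (2 * k + 1)) =
      ∑ j ∈ Finset.range (M + 1), gaussBinom (q ^ 2) M j * q ^ (j ^ 2) * z ^ j := by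
  induction M with
  | zero => intro z; simp [gaussBinom]
  | succ M ih =>
    intro z
    -- Removing the factor `k = 0` leaves the shorter product at `z q²`, which is why the induction
    -- keeps `z` general.
    rw [Finset.prod_range_succ']
    have : ∏ k ∈ Finset.range M, (1 + z * q ^ (2 * (k + 1) + 1)) =
        ∏ k ∈ Finset.range M, (1 + (z * q ^ 2) * q ^ (2 * k + 1)) :=
      Finset.prod_congr rfl fun k _ => by ring
    rw [this, ih, Finset.sum_range_succ' _ (M + 1)]
    simp only [gaussBinom_succ_succ, gaussBinom_zero_right]
    have e : ∀ j, (gaussBinom (q ^ 2) M j + (q ^ 2) ^ (j + 1) * gaussBinom (q ^ 2) M (j + 1)) *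
        q ^ (j + 1) ^ 2 * z ^ (j + 1) =
        (gaussBinom (q ^ 2) M j * q ^ (j ^ 2) * (z * q ^ 2) ^ j) * (z * q) +
        gaussBinom (q ^ 2) M (j + 1) * q ^ (j + 1) ^ 2 * (z * q ^ 2) ^ (j + 1) := fun j => by ring
    simp only [e, Finset.sum_add_distrib, ← Finset.sum_mul]
    have e2 := Finset.sum_range_succ'
      (fun j => gaussBinom (q ^ 2) M j * q ^ (j ^ 2) * (z * q ^ 2) ^ j) (M + 1)
    rw [Finset.sum_range_succ, gaussBinom_eq_zero_of_lt _ (Nat.lt_succ_self M)] at e2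
    simp only [gaussBinom_zero_right] at e2
    simp only [mul_zero, zero_add, pow_one, pow_zero, mul_one, zero_mul, add_zero, ne_eq,
      OfNat.ofNat_ne_zero, not_false_eq_true, zero_pow] at e2 ⊢
    linear_combination e2

lemma prod_one_add_mul_inv_pow {q z : ℝ} (hq : q ≠ 0) (hz : z ≠ 0) (N : ℕ) :
    ∏ k ∈ Finset.range N, (1 + z / q ^ (2 * N) * q ^ (2 * k + 1)) =
      z ^ N / q ^ (N ^ 2) * ∏ k ∈ Finset.range N, (1 + z⁻¹ * q ^ (2 * k + 1)) := by
  induction N with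
  | zero => simp
  | succ N ih =>
    rw [Finset.prod_range_succ', Finset.prod_range_succ]
    have : ∏ k ∈ Finset.range N, (1 + z / q ^ (2 * (N + 1)) * q ^ (2 * (k + 1) + 1)) =
        ∏ k ∈ Finset.range N, (1 + z / q ^ (2 * N) * q ^ (2 * k + 1)) :=
      Finset.prod_congr rfl fun k _ => by field_simp; ring
    rw [this, ih]
    field_simp
    ring

/-- The `q`-binomial theorem with `2N` factors, evaluated at `z / q^{2N}` so that the exponents of
`q` become symmetric about 0. The half with negative exponents is reflected into factors in `z⁻¹`.
-/
lemma finite_jacobi_triple_product {q z : ℝ} (hq : q ≠ 0) (hz : z ≠ 0) (N : ℕ) :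
    (∏ k ∈ Finset.range N, (1 + z * q ^ (2 * k + 1))) *
        ∏ k ∈ Finset.range N, (1 + z⁻¹ * q ^ (2 * k + 1)) =
      ∑ j ∈ Finset.range (2 * N + 1), gaussBinom (q ^ 2) (2 * N) j *
        (q ^ (((j : ℤ) - N) ^ 2) * z ^ ((j : ℤ) - N)) := by
  have h := prod_one_add_mul_pow q (2 * N) (z / q ^ (2 * N))
  rw [two_mul N, Finset.prod_range_add, ← two_mul, prod_one_add_mul_inv_pow hq hz] at h
  have e1 : ∏ k ∈ Finset.range N, (1 + z / q ^ (2 * N) * q ^ (2 * (N + k) + 1)) =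
      ∏ k ∈ Finset.range N, (1 + z * q ^ (2 * k + 1)) :=
    Finset.prod_congr rfl fun k _ => by field_simp; ring
  rw [e1] at h
  have e2 : (∏ k ∈ Finset.range N, (1 + z * q ^ (2 * k + 1))) *
      ∏ k ∈ Finset.range N, (1 + z⁻¹ * q ^ (2 * k + 1)) = q ^ (N ^ 2) / z ^ N *
      (z ^ N / q ^ (N ^ 2) * (∏ k ∈ Finset.range N, (1 + z⁻¹ * q ^ (2 * k + 1))) *
        ∏ k ∈ Finset.range N, (1 + z * q ^ (2 * k + 1))) := by
    field_simp
  rw [e2, h, Finset.mul_sum]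
  refine Finset.sum_congr rfl fun j _ => ?_
  have e3 : q ^ (((j : ℤ) - N) ^ 2) = q ^ (j ^ 2) * q ^ (N ^ 2) / (q ^ (2 * N)) ^ j := by
    rw [show ((j : ℤ) - N) ^ 2 = ((j ^ 2 : ℕ) : ℤ) + ((N ^ 2 : ℕ) : ℤ) - ((2 * N * j : ℕ) : ℤ) by
      push_cast; ring, zpow_sub₀ hq, zpow_add₀ hq, zpow_natCast, zpow_natCast, zpow_natCast,
      pow_mul q (2 * N) j]
  rw [e3, zpow_sub₀ hz, zpow_natCast, zpow_natCast, div_pow]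
  field_simp

lemma summable_pow_sq_mul_pow {q z : ℝ} (h0 : 0 < q) (h1 : q < 1) (hz : 0 < z) :
    Summable fun n : ℕ => q ^ (n ^ 2) * z ^ n := by
  refine summable_of_ratio_test_tendsto_lt_one (l := 0) zero_lt_one
    (Eventually.of_forall fun n => by positivity) ?_
  have : ∀ n : ℕ, ‖q ^ ((n + 1) ^ 2) * z ^ (n + 1)‖ / ‖q ^ (n ^ 2) * z ^ n‖ =
      (q ^ 2) ^ n * (q * z) := fun n => by
    rw [Real.norm_of_nonneg (by positivity), Real.norm_of_nonneg (by positivity)]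
    field_simp
    ring
  simp only [this]
  simpa using (tendsto_pow_atTop_nhds_zero_of_lt_one (sq_nonneg q)
    (pow_lt_one₀ h0.le h1 two_ne_zero)).mul_const (q * z)

lemma summable_zpow_sq_mul_zpow {q z : ℝ} (h0 : 0 < q) (h1 : q < 1) (hz : 0 < z) :
    Summable fun n : ℤ => q ^ (n ^ 2) * z ^ n := by
  refine Summable.of_nat_of_neg ?_ ?_
  · simpa [← zpow_natCast] using summable_pow_sq_mul_pow h0 h1 hz
  · simpa [← zpow_natCast] using summable_pow_sq_mul_pow h0 h1 (inv_pos.2 hz)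

/-- The **Jacobi triple product identity**. -/
theorem jacobi_triple_product {q z : ℝ} (h0 : 0 < q) (h1 : q < 1) (hz : 0 < z) :
    ∑' n : ℤ, q ^ (n ^ 2) * z ^ n = qPochhammerInf (q ^ 2) (q ^ 2) *
      (qPochhammerInf (-(z * q)) (q ^ 2) * qPochhammerInf (-(z⁻¹ * q)) (q ^ 2)) := by
  have hQ0 : 0 ≤ q ^ 2 := sq_nonneg q
  have hQ1 : q ^ 2 < 1 := pow_lt_one₀ h0.le h1 two_ne_zero
  set P := qPochhammerInf (q ^ 2) (q ^ 2) with hP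
  have hPpos : 0 < P := qPochhammerInf_self_pos hQ0 hQ1
  -- The cut-off below `-N` is needed because `toNat` would return 0 there and give the coefficient
  -- 1. Above `N` the Gaussian binomial vanishes by itself.
  let f : ℕ → ℤ → ℝ := fun N n =>
    if -(N : ℤ) ≤ n then gaussBinom (q ^ 2) (2 * N) (n + N).toNat * (q ^ (n ^ 2) * z ^ n) else 0
  have hsum : ∀ N, ∑' n, f N n = (∏ k ∈ Finset.range N, (1 - -(z * q) * (q ^ 2) ^ k)) *
      ∏ k ∈ Finset.range N, (1 - -(z⁻¹ * q) * (q ^ 2) ^ k) := by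
    intro N
    have hinj : Function.Injective fun j : ℕ => (j : ℤ) - N := fun a b h => by
      simpa using h
    rw [← hinj.tsum_eq (f := f N), tsum_eq_sum (s := Finset.range (2 * N + 1))]
    · have e := finite_jacobi_triple_product h0.ne' hz.ne' N
      have e1 : ∀ y : ℝ, ∏ k ∈ Finset.range N, (1 - -(y * q) * (q ^ 2) ^ k) =
        ∏ k ∈ Finset.range N, (1 + y * q ^ (2 * k + 1)) := fun y =>
          Finset.prod_congr rfl fun k _ => by ring
      rw [e1, e1, e]
      refine Finset.sum_congr rfl fun j _ => ?_
      simp [f]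
    · intro j hj
      simp only [Finset.mem_range, not_lt] at hj
      simp [f, gaussBinom_eq_zero_of_lt (q ^ 2) (show 2 * N < j by omega)]
    · intro n hn
      simp only [f, Function.mem_support, ne_eq, ite_eq_right_iff, not_forall] at hn
      obtain ⟨hn, -⟩ := hn
      exact ⟨(n + N).toNat, by dsimp only; omega⟩
  have hgauss : ∀ (N : ℕ) (n : ℤ), -(N : ℤ) ≤ n → n ≤ N →
      gaussBinom (q ^ 2) (2 * N) (n + N).toNat = qFactorial (q ^ 2) (2 * N) /
        (qFactorial (q ^ 2) (n + N).toNat * qFactorial (q ^ 2) (N - n).toNat) := by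
    intro N n hn hn'
    rw [eq_div_iff (mul_pos (qFactorial_pos hQ0 hQ1 _) (qFactorial_pos hQ0 hQ1 _)).ne',
      ← mul_assoc]
    exact gaussBinom_mul_qFactorial _ _ _ _ (by omega)
  -- A majorant independent of `N`: the numerator `(Q;Q)_{2N}` is at most 1 and each denominator
  -- factor is at least its limit `P`. Dominated convergence then applies termwise.
  have hbound : ∀ N n, ‖f N n‖ ≤ 1 / (P * P) * (q ^ (n ^ 2) * z ^ n) := by
    intro N n
    have hpos : 0 < q ^ (n ^ 2) * z ^ n := mul_pos (zpow_pos h0 _) (zpow_pos hz _)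
    simp only [f]
    split_ifs with hn
    · rw [norm_mul, Real.norm_of_nonneg hpos.le, Real.norm_of_nonneg (gaussBinom_nonneg hQ0 _ _)]
      refine mul_le_mul_of_nonneg_right ?_ hpos.le
      rcases le_or_gt n N with hn' | hn'
      · rw [hgauss N n hn hn']
        refine div_le_div₀ zero_le_one ?_ (mul_pos hPpos hPpos) ?_
        · simpa [qFactorial] using qFactorial_antitone hQ0 hQ1 (Nat.zero_le (2 * N))
        · exact mul_le_mul (qPochhammerInf_self_le_qFactorial hQ0 hQ1 _)
            (qPochhammerInf_self_le_qFactorial hQ0 hQ1 _) hPpos.le (qFactorial_pos hQ0 hQ1 _).le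
      · rw [gaussBinom_eq_zero_of_lt _ (by omega)]
        positivity
    · rw [norm_zero]
      positivity
  have hfac : Tendsto (qFactorial (q ^ 2)) atTop (𝓝 P) := tendsto_prod_qPochhammerInf _ hQ0 hQ1
  have hlim : ∀ n, Tendsto (fun N => f N n) atTop (𝓝 (P / (P * P) * (q ^ (n ^ 2) * z ^ n))) := by
    intro n
    have t1 : Tendsto (fun N : ℕ => 2 * N) atTop atTop :=
      tendsto_atTop.2 fun b => eventually_atTop.2 ⟨b, fun N hN => by omega⟩
    have t2 : Tendsto (fun N : ℕ => (n + N).toNat) atTop atTop :=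
      tendsto_atTop.2 fun b => eventually_atTop.2 ⟨b + n.natAbs, fun N hN => by omega⟩
    have t3 : Tendsto (fun N : ℕ => (N - n).toNat) atTop atTop :=
      tendsto_atTop.2 fun b => eventually_atTop.2 ⟨b + n.natAbs, fun N hN => by omega⟩
    have := ((hfac.comp t1).div ((hfac.comp t2).mul (hfac.comp t3))
      (mul_pos hPpos hPpos).ne').mul_const (q ^ (n ^ 2) * z ^ n)
    refine this.congr' (eventually_atTop.2 ⟨n.natAbs, fun N hN => ?_⟩)
    simp only [f, Function.comp, Pi.div_apply]
    rw [if_pos (by omega), hgauss N n (by omega) (by omega)]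
  have key := tendsto_tsum_of_dominated_convergence (𝓕 := atTop)
    ((summable_zpow_sq_mul_zpow h0 h1 hz).mul_left (1 / (P * P))) hlim
    (Eventually.of_forall hbound)
  simp only [hsum, tsum_mul_left] at key
  have := tendsto_nhds_unique key ((tendsto_prod_qPochhammerInf (-(z * q)) hQ0 hQ1).mul
    (tendsto_prod_qPochhammerInf (-(z⁻¹ * q)) hQ0 hQ1))
  rw [← this]
  field_simp

/-! ### The functions `ϑ₃`, `η` and `𝔣` on the imaginary axis -/

/-- The nome `e^{-πt}` attached to the point `it` of the upper half plane. -/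
def nome (t : ℝ) : ℝ := Real.exp (-Real.pi * t)

lemma nome_pos (t : ℝ) : 0 < nome t := Real.exp_pos _

lemma nome_lt_one {t : ℝ} (ht : 0 < t) : nome t < 1 :=
  Real.exp_lt_one_iff.2 (by nlinarith [Real.pi_pos])

lemma nome_natCast_mul (n : ℕ) (t : ℝ) : nome (n * t) = nome t ^ n := by
  rw [nome, nome, ← Real.exp_nat_mul]
  ring_nf

lemma nome_five_mul (t : ℝ) : nome (5 * t) = nome t ^ 5 := by
  simpa using nome_natCast_mul 5 t

/-- The theta constant `ϑ₃(it) = ∑ q^{n²}`. -/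
def thetaThree (t : ℝ) : ℝ := ∑' n : ℤ, nome t ^ (n ^ 2)

/-- The Dedekind eta function at `it`. -/
def etaImag (t : ℝ) : ℝ := Real.exp (-Real.pi * t / 12) * qPochhammerInf (nome t ^ 2) (nome t ^ 2)

/-- The Weber function `𝔣` at `it`. -/
def weberF (t : ℝ) : ℝ := Real.exp (Real.pi * t / 24) * ramanujanChi (nome t)

lemma one_le_ramanujanChi {q : ℝ} (h0 : 0 ≤ q) (h1 : q < 1) : 1 ≤ ramanujanChi q :=
  one_le_qPochhammerInf_neg h0 (sq_nonneg q) (pow_lt_one₀ h0 h1 two_ne_zero)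

lemma exp_le_weberF {t : ℝ} (ht : 0 < t) : Real.exp (Real.pi * t / 24) ≤ weberF t :=
  le_mul_of_one_le_right (Real.exp_pos _).le
    (one_le_ramanujanChi (nome_pos t).le (nome_lt_one ht))

lemma weberF_pos {t : ℝ} (ht : 0 < t) : 0 < weberF t :=
  (Real.exp_pos _).trans_le (exp_le_weberF ht)

lemma etaImag_pos {t : ℝ} (ht : 0 < t) : 0 < etaImag t :=
  mul_pos (Real.exp_pos _) (qPochhammerInf_self_pos (sq_nonneg _)
    (pow_lt_one₀ (nome_pos t).le (nome_lt_one ht) two_ne_zero))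

lemma thetaThree_eq {t : ℝ} (ht : 0 < t) : thetaThree t = etaImag t * weberF t ^ 2 := by
  have h := jacobi_triple_product (nome_pos t) (nome_lt_one ht) zero_lt_one
  simp only [one_zpow, mul_one, inv_one, one_mul] at h
  have e : Real.exp (-Real.pi * t / 12) * Real.exp (Real.pi * t / 24) ^ 2 = 1 := by
    rw [← Real.exp_nat_mul, ← Real.exp_add, Real.exp_eq_one_iff]
    push_cast
    ring
  rw [thetaThree, h, etaImag, weberF, ramanujanChi]
  linear_combination (-(qPochhammerInf (nome t ^ 2) (nome t ^ 2) *
    qPochhammerInf (-nome t) (nome t ^ 2) ^ 2)) * e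

/-- Poisson summation for the Gaussian. -/
lemma thetaThree_inv {t : ℝ} (ht : 0 < t) : thetaThree (1 / t) = √t * thetaThree t := by
  have h := Real.tsum_exp_neg_mul_int_sq ht
  have e : ∀ s : ℝ, thetaThree s = ∑' n : ℤ, Real.exp (-Real.pi * s * (n : ℝ) ^ 2) := fun s =>
    tsum_congr fun n => by
      rw [nome, ← Real.rpow_intCast, ← Real.exp_mul]
      push_cast
      ring_nf
  rw [e, e, h, ← Real.sqrt_eq_rpow]
  have := Real.sqrt_pos.2 ht
  field_simp

lemma eta_I_mul {t : ℝ} (ht : 0 < t) : ModularForm.eta (Complex.I * t) = etaImag t := by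
  rw [ModularForm.eta, etaImag, Complex.ofReal_mul]
  congr 1
  · rw [Function.Periodic.qParam, Complex.ofReal_exp]
    congr 1
    push_cast
    linear_combination (2 * Real.pi * t / 24 : ℂ) * Complex.I_mul_I
  · have hm := multipliable_qPochhammerInf (nome t ^ 2) (nome t ^ 2)
      (norm_lt_one_of_mem (sq_nonneg _) (pow_lt_one₀ (nome_pos t).le (nome_lt_one ht) two_ne_zero))
    have := hm.map_tprod Complex.ofRealHom Complex.continuous_ofReal
    rw [qPochhammerInf]
    refine Eq.trans (tprod_congr fun n => ?_) this.symm
    have e : ((nome t ^ 2 : ℝ) : ℂ) = Complex.exp (2 * Real.pi * Complex.I * (Complex.I * t)) := by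
      rw [nome, ← Real.exp_nat_mul, Complex.ofReal_exp]
      congr 1
      push_cast
      linear_combination (-(2 * Real.pi * t) : ℂ) * Complex.I_mul_I
    rw [ModularForm.eta_q_eq_pow, ← e]
    simp [pow_succ']

lemma csqrt_pow_24 {z : ℂ} (hz : z ≠ 0) : Complex.sqrt z ^ 24 = z ^ 12 := by
  rw [sqrt_eq_exp hz, ← Complex.exp_nat_mul,
    show ((24 : ℕ) : ℂ) * (Complex.log z / 2) = (12 : ℕ) * Complex.log z by push_cast; ring,
    Complex.exp_nat_mul, Complex.exp_log hz]

/-- The complex transformation law involves branches of the square root. Taking 24th powers removes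
them, and positivity on the imaginary axis recovers the real identity. -/
lemma etaImag_inv {t : ℝ} (ht : 0 < t) : etaImag (1 / t) = √t * etaImag t := by
  have hmem : Complex.I * t ∈ UpperHalfPlane.upperHalfPlaneSet := by
    simpa [UpperHalfPlane.upperHalfPlaneSet] using ht
  have h := ModularForm.eta_comp_eq_csqrt_I_inv hmem
  have ht0 : (t : ℂ) ≠ 0 := Complex.ofReal_ne_zero.2 ht.ne'
  have e : -1 / (Complex.I * t) = Complex.I * ((1 / t : ℝ) : ℂ) := by
    push_cast
    field_simp
    simp
  simp only [Function.comp, Pi.smul_apply, Pi.mul_apply, smul_eq_mul, e] at h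
  rw [eta_I_mul ht, eta_I_mul (one_div_pos.2 ht)] at h
  have h24 := congrArg (· ^ 24) h
  rw [mul_pow, mul_pow, inv_pow, csqrt_pow_24 Complex.I_ne_zero,
    csqrt_pow_24 (mul_ne_zero Complex.I_ne_zero ht0)] at h24
  have hI : Complex.I ^ 12 = 1 := by
    rw [show 12 = 4 * 3 by norm_num, pow_mul, Complex.I_pow_four, one_pow]
  rw [hI, inv_one, mul_pow, hI, one_mul, one_mul] at h24
  have h24' : etaImag (1 / t) ^ 24 = (√t * etaImag t) ^ 24 := by
    have : √t ^ 24 = t ^ 12 := by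
      rw [show 24 = 2 * 12 by norm_num, pow_mul, Real.sq_sqrt ht.le]
    rw [mul_pow, this]
    exact_mod_cast h24
  exact (pow_left_inj₀ (etaImag_pos (one_div_pos.2 ht)).le
    (mul_nonneg (Real.sqrt_nonneg t) (etaImag_pos ht).le) (by norm_num)).1 h24'

/-- In `ϑ₃ = η 𝔣²` both `ϑ₃` and `η` acquire the factor `√t`, so `𝔣²` is invariant. -/
lemma weberF_inv {t : ℝ} (ht : 0 < t) : weberF (1 / t) = weberF t := by
  have ht' := one_div_pos.2 ht
  have h := thetaThree_inv ht
  rw [thetaThree_eq ht, thetaThree_eq ht', etaImag_inv ht, mul_assoc] at h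
  have h2 := mul_left_cancel₀ (etaImag_pos ht).ne'
    (mul_left_cancel₀ (Real.sqrt_pos.2 ht).ne' h)
  exact (pow_left_inj₀ (weberF_pos ht').le (weberF_pos ht).le two_ne_zero).1 h2

lemma classInvariantG_eq_weberF (n : ℚ) :
    classInvariantG n = (2 : ℝ) ^ (-(1 / 4) : ℝ) * weberF √(n : ℝ) := by
  rw [classInvariantG, weberF, ← Real.exp_mul, nome, mul_assoc]
  congr 3
  ring

/-! ### The modular equation of degree five -/

/-- The decomposition of `ℤ[i]` into the cosets of the ideal `(2 + i)`. -/
def gaussianCosetEquiv : Fin 5 × ℤ × ℤ ≃ ℤ × ℤ where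
  toFun p := (2 * p.2.1 - p.2.2 + (p.1 : ℕ), p.2.1 + 2 * p.2.2)
  -- For `(a, b) = (2x - y + j, x + 2y)` one has `a - 2b = j - 5y`, which determines `j` and `y`;
  -- then `x = b - 2y`.
  invFun c := (⟨((c.1 - 2 * c.2) % 5).toNat, by omega⟩,
    c.2 + 2 * ((c.1 - 2 * c.2) / 5), -((c.1 - 2 * c.2) / 5))
  left_inv := by
    rintro ⟨j, x, y⟩
    have := j.isLt
    ext <;> dsimp only <;> omega
  right_inv := by
    rintro ⟨a, b⟩
    ext <;> dsimp only <;> omega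

lemma tsum_shift (f : ℤ → ℝ) (c : ℤ) : ∑' n, f (n + c) = ∑' n, f n :=
  (Equiv.addRight c).tsum_eq f

lemma tsum_zpow_sq_mul_inv_zpow (q z : ℝ) :
    ∑' n : ℤ, q ^ (n ^ 2) * z⁻¹ ^ n = ∑' n : ℤ, q ^ (n ^ 2) * z ^ n := by
  rw [← (Equiv.neg ℤ).tsum_eq]
  simp

/-- With `F(a) = ∑ q^{5n² + an}`, the coset of `j` contributes `q^{j²} F(4j) F(-2j)`. Up to a power
of `q`, `F(a)` depends only on `±a` modulo 10, and the four nonzero cosets all contribute `q F(4)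
F(2)`. -/
lemma tsum_zpow_sq_sq {q : ℝ} (h0 : 0 < q) (h1 : q < 1) :
    (∑' n : ℤ, q ^ (n ^ 2)) ^ 2 = (∑' n : ℤ, (q ^ 5) ^ (n ^ 2)) ^ 2 +
      4 * q * ((∑' n : ℤ, (q ^ 5) ^ (n ^ 2) * (q ^ 4) ^ n) *
        ∑' n : ℤ, (q ^ 5) ^ (n ^ 2) * (q ^ 2) ^ n) := by
  have hq5 : q ^ 5 < 1 := pow_lt_one₀ h0.le h1 (by norm_num)
  have h5 : 0 < q ^ 5 := pow_pos h0 5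
  have hs : Summable fun n : ℤ => q ^ (n ^ 2) := by
    simpa using summable_zpow_sq_mul_zpow h0 h1 zero_lt_one
  have hs0 : 0 ≤ fun n : ℤ => q ^ (n ^ 2) := fun n => (zpow_pos h0 _).le
  have hs2 := hs.mul_of_nonneg hs hs0 hs0
  have e0 : (∑' n : ℤ, q ^ (n ^ 2)) ^ 2 = ∑' p : ℤ × ℤ, q ^ (p.1 ^ 2) * q ^ (p.2 ^ 2) := by
    rw [sq, hs.tsum_mul_tsum hs hs2]
  have hprod : ∀ {a b : ℤ}, (∑' p : ℤ × ℤ, ((q ^ 5) ^ (p.1 ^ 2) * (q ^ a) ^ p.1) *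
      ((q ^ 5) ^ (p.2 ^ 2) * (q ^ b) ^ p.2)) =
      (∑' n : ℤ, (q ^ 5) ^ (n ^ 2) * (q ^ a) ^ n) * ∑' n : ℤ, (q ^ 5) ^ (n ^ 2) * (q ^ b) ^ n := by
    intro a b
    have ha := summable_zpow_sq_mul_zpow h5 hq5 (zpow_pos h0 a)
    have hb := summable_zpow_sq_mul_zpow h5 hq5 (zpow_pos h0 b)
    exact (ha.tsum_mul_tsum hb (ha.mul_of_nonneg hb
      (fun n => mul_nonneg (zpow_pos h5 _).le (zpow_pos (zpow_pos h0 _) _).le)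
      (fun n => mul_nonneg (zpow_pos h5 _).le (zpow_pos (zpow_pos h0 _) _).le))).symm
  have hq : q ≠ 0 := h0.ne'
  have e5 : ∀ m : ℤ, (q ^ 5) ^ m = q ^ (5 * m) := fun m => by
    rw [← zpow_natCast, ← zpow_mul]; rfl
  obtain ⟨F, hF⟩ : ∃ F : ℤ → ℝ, ∀ a, F a = ∑' n : ℤ, (q ^ 5) ^ (n ^ 2) * (q ^ a) ^ n :=
    ⟨_, fun _ => rfl⟩
  have hcoset : ∀ (j : ℕ), (∑' p : ℤ × ℤ, q ^ ((2 * p.1 - p.2 + (j : ℤ)) ^ 2) *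
      q ^ ((p.1 + 2 * p.2) ^ 2)) = q ^ ((j : ℤ) ^ 2) * (F (4 * j) * F (-2 * j)) := by
    intro j
    rw [hF, hF, ← hprod, ← tsum_mul_left]
    refine tsum_congr fun p => ?_
    simp only [e5, ← zpow_mul, ← zpow_add₀ hq]
    congr 1
    ring
  have hshift : ∀ a c : ℤ, F a = q ^ (5 * c ^ 2 + a * c) * F (a + 10 * c) := by
    intro a c
    rw [hF, hF, ← tsum_shift _ c, ← tsum_mul_left]
    refine tsum_congr fun n => ?_
    simp only [e5, ← zpow_mul, ← zpow_add₀ hq]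
    congr 1
    ring
  have hneg : ∀ a : ℤ, F (-a) = F a := fun a => by
    rw [hF, hF, zpow_neg, tsum_zpow_sq_mul_inv_zpow]
  have f0 : F 0 = ∑' n : ℤ, (q ^ 5) ^ (n ^ 2) := by simp [hF]
  have f4 : F 4 = ∑' n : ℤ, (q ^ 5) ^ (n ^ 2) * (q ^ 4) ^ n := by rw [hF]; norm_cast
  have f2 : F 2 = ∑' n : ℤ, (q ^ 5) ^ (n ^ 2) * (q ^ 2) ^ n := by rw [hF]; norm_cast
  rw [e0, ← gaussianCosetEquiv.tsum_eq, Summable.tsum_prod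
    (by simpa [Function.comp_def] using gaussianCosetEquiv.summable_iff.2 hs2), tsum_fintype,
    Fin.sum_univ_five, ← f0, ← f2, ← f4]
  simp only [gaussianCosetEquiv, Equiv.coe_fn_mk, hcoset]
  have f8 := hshift 8 (-1)
  have f12 := hshift 12 (-1)
  have f6 := hshift (-6) 1
  have f16 := hshift 16 (-2)
  have f8' := hshift (-8) 1
  have f2' := hneg 2
  have f4' := hneg 4
  norm_num at f8 f12 f6 f16 f8' ⊢
  rw [f8, f12, f6, f16, f8', f2', f4']
  field_simp
  ring

/-- Ramanujan's identity `φ²(q) - φ²(q⁵) = 4 q f(q, q⁹) f(q³, q⁷)`, written in terms of `ϑ₃`,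
`𝔣` and `η`. -/
lemma thetaThree_sq_sub {t : ℝ} (ht : 0 < t) :
    weberF (5 * t) * (thetaThree t ^ 2 - thetaThree (5 * t) ^ 2) =
      4 * weberF t * etaImag (5 * t) ^ 2 := by
  set q := nome t with hq
  have h0 : 0 < q := nome_pos t
  have h1 : q < 1 := nome_lt_one ht
  have h50 : 0 < q ^ 5 := pow_pos h0 5
  have h51 : q ^ 5 < 1 := pow_lt_one₀ h0.le h1 (by norm_num)
  have hT : thetaThree t ^ 2 - thetaThree (5 * t) ^ 2 = 4 * q *
      ((∑' n : ℤ, (q ^ 5) ^ (n ^ 2) * (q ^ 4) ^ n) *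
        ∑' n : ℤ, (q ^ 5) ^ (n ^ 2) * (q ^ 2) ^ n) := by
    rw [thetaThree, thetaThree, nome_five_mul, ← hq, tsum_zpow_sq_sq h0 h1]
    ring
  -- Modulo 10, the two theta series supply the exponents 1, 3, 7, 9 of `χ(q)`. The missing class 5
  -- is `χ(q⁵)`, hence the factor `weberF (5 * t)` on the left.
  have hχ := qPochhammerInf_eq_prod_five (-q) (sq_nonneg q) (pow_lt_one₀ h0.le h1 two_ne_zero)
  have i1 : -((q ^ 4)⁻¹ * q ^ 5) = -q := by field_simp
  have i2 : -((q ^ 2)⁻¹ * q ^ 5) = -q ^ 3 := by field_simp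
  have j1 : -q * q ^ 2 = -q ^ 3 := by ring
  have j2 : -q * (q ^ 2) ^ 2 = -q ^ 5 := by ring
  have j3 : -q * (q ^ 2) ^ 3 = -q ^ 7 := by ring
  have j4 : -q * (q ^ 2) ^ 4 = -q ^ 9 := by ring
  have k1 : -(q ^ 4 * q ^ 5) = -q ^ 9 := by ring
  have k2 : -(q ^ 2 * q ^ 5) = -q ^ 7 := by ring
  have k3 : (q ^ 2) ^ 5 = (q ^ 5) ^ 2 := by ring
  rw [j1, j2, j3, j4, k3] at hχ
  have e : q * Real.exp (Real.pi * (5 * t) / 24) =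
      Real.exp (Real.pi * t / 24) * Real.exp (-Real.pi * (5 * t) / 12) ^ 2 := by
    rw [hq, nome, ← Real.exp_nat_mul, ← Real.exp_add, ← Real.exp_add]
    congr 1
    push_cast
    ring
  rw [hT, jacobi_triple_product h50 h51 (pow_pos h0 4), jacobi_triple_product h50 h51 (pow_pos h0 2),
    i1, i2, k1, k2, weberF, weberF, etaImag, nome_five_mul, ← hq, ramanujanChi, ramanujanChi, hχ]
  linear_combination (4 * qPochhammerInf ((q ^ 5) ^ 2) ((q ^ 5) ^ 2) ^ 2 *
    (qPochhammerInf (-q) ((q ^ 5) ^ 2) * qPochhammerInf (-q ^ 3) ((q ^ 5) ^ 2) *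
      qPochhammerInf (-q ^ 5) ((q ^ 5) ^ 2) * qPochhammerInf (-q ^ 7) ((q ^ 5) ^ 2) *
      qPochhammerInf (-q ^ 9) ((q ^ 5) ^ 2))) * e

/-- The image of `thetaThree_sq_sub` under `t ↦ 1/(5t)`, which exchanges the roles of `t` and `5t`.
-/
lemma thetaThree_sq_sub_dual {t : ℝ} (ht : 0 < t) :
    weberF t * (5 * thetaThree (5 * t) ^ 2 - thetaThree t ^ 2) =
      4 * weberF (5 * t) * etaImag t ^ 2 := by
  have h5 : 0 < 5 * t := by positivity
  have h := thetaThree_sq_sub (one_div_pos.2 h5)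
  rw [show 5 * (1 / (5 * t)) = 1 / t by field_simp, weberF_inv ht, weberF_inv h5,
    thetaThree_inv ht, thetaThree_inv h5, etaImag_inv ht] at h
  simp only [mul_pow, Real.sq_sqrt ht.le, Real.sq_sqrt h5.le] at h
  refine mul_left_cancel₀ ht.ne' ?_
  linear_combination h

/-- The Schläfli modular equation of degree five, for `u = 𝔣(τ)` and `v = 𝔣(5τ)`. -/
theorem weberF_modular_equation {t : ℝ} (ht : 0 < t) :
    weberF t ^ 5 * weberF (5 * t) ^ 5 =
      weberF t ^ 6 + weberF (5 * t) ^ 6 + 4 * weberF t * weberF (5 * t) := by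
  have h5 : 0 < 5 * t := by positivity
  have hA := thetaThree_sq_sub ht
  have hB := thetaThree_sq_sub_dual ht
  rw [thetaThree_eq ht, thetaThree_eq h5] at hA hB
  have hu := weberF_pos ht
  have hv := weberF_pos h5
  have hE := etaImag_pos h5
  set u := weberF t
  set v := weberF (5 * t)
  set r := etaImag t ^ 2
  set s := etaImag (5 * t)
  have hA' : v * u ^ 4 * r = (v ^ 5 + 4 * u) * s ^ 2 := by linear_combination hA
  have hB' : 5 * u * v ^ 4 * s ^ 2 = (u ^ 5 + 4 * v) * r := by linear_combination hB
  have hne : 4 * s ^ 2 ≠ 0 := by positivity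
  refine mul_left_cancel₀ hne ?_
  -- The two relations determine `r / s²` in two ways; equating them gives `5u⁵v⁵ = (u⁵ + 4v)(v⁵ +
  -- 4u)`.
  linear_combination (v * u ^ 4) * hB' + (u ^ 5 + 4 * v) * hA'

/-! ### Evaluation of `G_125` -/

/-- At `t = 1/√5` one has `5t = 1/t`, so inversion expresses every term of `thetaThree_sq_sub` at
the single point `√5`. -/
lemma weberF_sqrt_five : weberF √5 ^ 4 = √5 + 1 := by
  have hs : 0 < √5 := by positivity
  have hss : √5 ^ 2 = 5 := Real.sq_sqrt (by norm_num)
  have h := thetaThree_sq_sub (one_div_pos.2 hs)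
  have e : 5 * (1 / √5) = √5 := by
    field_simp
    exact hss.symm
  rw [e, weberF_inv hs, thetaThree_inv hs, thetaThree_eq hs, mul_pow, Real.sq_sqrt hs.le] at h
  have hu := weberF_pos hs
  have hE := etaImag_pos hs
  have hne : weberF √5 * etaImag √5 ^ 2 ≠ 0 := by positivity
  have h4 : (√5 - 1) * weberF √5 ^ 4 = 4 := by
    refine mul_left_cancel₀ hne ?_
    linear_combination h
  linear_combination (√5 + 1) / 4 * h4 - weberF √5 ^ 4 / 4 * hss

/-- Serves to exclude the root `w = 1` of the sextic. The number 2 separates the values, since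
`e^{5π√5/24} ≥ 1 + 5π√5/24 > 2`. -/
lemma weberF_sqrt_five_lt : weberF √5 < weberF (5 * √5) := by
  have hss : √5 ^ 2 = 5 := Real.sq_sqrt (by norm_num)
  have hs2 : 2 < √5 := by
    rw [Real.lt_sqrt (by norm_num)]
    norm_num
  have hu : weberF √5 < 2 := by
    refine lt_of_pow_lt_pow_left₀ 4 (by norm_num) ?_
    rw [weberF_sqrt_five]
    nlinarith
  have hv := exp_le_weberF (show 0 < 5 * √5 by positivity)
  have he := Real.add_one_le_exp (Real.pi * (5 * √5) / 24)
  nlinarith [Real.pi_gt_three]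

lemma weberF_ratio_quintic {w : ℝ} (hw : weberF (5 * √5) = w * weberF √5) :
    w ^ 5 = √5 * (w ^ 4 + w ^ 3 + w ^ 2 + w) + 1 := by
  have hss : √5 ^ 2 = 5 := Real.sq_sqrt (by norm_num)
  have hu := weberF_pos (show 0 < √5 by positivity)
  have h4 := weberF_sqrt_five
  have hm := weberF_modular_equation (show 0 < √5 by positivity)
  have hlt := weberF_sqrt_five_lt
  rw [hw] at hm hlt
  set u := weberF √5
  have hw1 : w - 1 ≠ 0 := by
    intro h
    rw [sub_eq_zero.1 h, one_mul] at hlt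
    exact lt_irrefl _ hlt
  have h1 : (√5 + 1) ^ 2 * w ^ 5 = (√5 + 1) * (1 + w ^ 6) + 4 * w := by
    rw [← h4]
    refine mul_left_cancel₀ (pow_ne_zero 2 hu.ne') ?_
    linear_combination hm
  have h2 : (w - 1) * (w ^ 5 - √5 * (w ^ 4 + w ^ 3 + w ^ 2 + w) - 1) = 0 := by
    linear_combination (1 - √5) / 4 * h1 + ((√5 + 1) * w ^ 5 - (1 + w ^ 6)) / 4 * hss
  have h3 := (mul_eq_zero.1 h2).resolve_left hw1
  linear_combination h3

/-- Divided by `w⁵`, the equation reads `1 = s(w⁻¹ + w⁻² + w⁻³ + w⁻⁴) + w⁻⁵`, whose right side is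
strictly decreasing for `w > 0`. -/
lemma quintic_pos_root_unique {s w v : ℝ} (hs : 0 ≤ s) (hw : 0 < w) (hv : 0 < v)
    (hw5 : w ^ 5 = s * (w ^ 4 + w ^ 3 + w ^ 2 + w) + 1)
    (hv5 : v ^ 5 = s * (v ^ 4 + v ^ 3 + v ^ 2 + v) + 1) : w = v := by
  have key : ∀ a b : ℝ, 0 < a → 0 < b → a ^ 5 = s * (a ^ 4 + a ^ 3 + a ^ 2 + a) + 1 →
      b ^ 5 = s * (b ^ 4 + b ^ 3 + b ^ 2 + b) + 1 → ¬ a < b := by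
    intro a b ha hb ha5 hb5 hab
    have hp : ∀ n : ℕ, 0 ≤ b ^ n - a ^ n := fun n =>
      sub_nonneg.2 (pow_le_pow_left₀ ha.le hab.le n)
    have hp5 : a ^ 5 < b ^ 5 := pow_lt_pow_left₀ hab ha.le (by norm_num)
    have e : (b ^ 5 - a ^ 5) + s * (a ^ 4 * b ^ 4 * (b ^ 1 - a ^ 1) + a ^ 3 * b ^ 3 * (b ^ 2 - a ^ 2)
        + a ^ 2 * b ^ 2 * (b ^ 3 - a ^ 3) + a * b * (b ^ 4 - a ^ 4)) = 0 := by
      linear_combination a ^ 5 * hb5 - b ^ 5 * ha5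
    have h1 := hp 1
    have h2 := hp 2
    have h3 := hp 3
    have h4 := hp 4
    have : 0 ≤ s * (a ^ 4 * b ^ 4 * (b ^ 1 - a ^ 1) + a ^ 3 * b ^ 3 * (b ^ 2 - a ^ 2)
        + a ^ 2 * b ^ 2 * (b ^ 3 - a ^ 3) + a * b * (b ^ 4 - a ^ 4)) := by positivity
    linarith
  exact le_antisymm (not_lt.1 (key v w hv hw hv5 hw5)) (not_lt.1 (key w v hw hv hw5 hv5))

/-- If `A B = √5 - 1` and `A⁵ + B⁵ = 20√5 - 36`, then an explicit element of `ℚ(√5, A + B)` is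
a root of the quintic satisfied by `G_125 / G_5`. -/
lemma quintic_radical_root {s x m w : ℝ} (hs : s ^ 2 = 5)
    (hx : x ^ 5 - 5 * (s - 1) * x ^ 3 + 5 * (s - 1) ^ 2 * x = 20 * s - 36)
    (hm : m = (1 + x) ^ 2) (hw : w = (5 + s) / 20 * m - (1 + s) / 4) :
    w ^ 5 = s * (w ^ 4 + w ^ 3 + w ^ 2 + w) + 1 := by
  -- Each power of `w` is reduced by `s² = 5` to coefficients linear in `s`. The quintic then has
  -- degree 10 in `x`, and the cofactor of `hx` below is its quotient by the quintic relation for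
  -- `x`.
  have w2 : w ^ 2 = (s + 3) / 40 * m ^ 2 - (3 * s + 5) / 20 * m + (s + 3) / 8 := by
    rw [hw]
    linear_combination (m ^ 2 / 400 - m / 40 + 1 / 16) * hs
  have w3 : w ^ 3 = (2 * s + 5) / 200 * m ^ 3 - (3 * s + 6) / 40 * m ^ 2 + (6 * s + 15) / 40 * m -
      (s + 2) / 8 := by
    rw [pow_succ, w2, hw]
    linear_combination (m ^ 3 / 800 - 11 / 800 * m ^ 2 + 7 / 160 * m - 1 / 32) * hs
  have w4 : w ^ 4 = (3 * s + 7) / 800 * m ^ 4 - (7 * s + 15) / 200 * m ^ 3 +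
      (9 * s + 21) / 80 * m ^ 2 - (7 * s + 15) / 40 * m + (3 * s + 7) / 32 := by
    rw [pow_succ, w3, hw]
    linear_combination (m ^ 4 / 2000 - m ^ 3 / 160 + 21 / 800 * m ^ 2 - 7 / 160 * m + 1 / 32) * hs
  have w5 : w ^ 5 = (11 * s + 25) / 8000 * m ^ 5 - (5 * s + 11) / 320 * m ^ 4 +
      (11 * s + 25) / 160 * m ^ 3 - (5 * s + 11) / 32 * m ^ 2 + (11 * s + 25) / 64 * m -
      (5 * s + 11) / 64 := by
    rw [pow_succ, w4, hw]
    linear_combination (3 / 16000 * m ^ 5 - 43 / 16000 * m ^ 4 + 23 / 1600 * m ^ 3 -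
      59 / 1600 * m ^ 2 + 31 / 640 * m - 3 / 128) * hs
  rw [w5, w4, w3, w2, hw, hm]
  linear_combination ((11 * s + 25) / 8000 * x ^ 5 + (11 * s + 25) / 800 * x ^ 4 +
    (37 * s + 85) / 800 * x ^ 3 + (23 * s + 55) / 400 * x ^ 2 + (3 * s + 10) / 200 * x +
    (7 * s + 25) / 1000) * hx +
    (-3 / 800 * (1 + x) ^ 8 + (1 + x) ^ 6 / 40 - (1 + x) ^ 4 / 16 + (1 + x) ^ 2 / 8 + 5 / 32 +
    11 / 1600 * x ^ 8 + 11 / 160 * x ^ 7 - 11 / 1600 * x ^ 6 * s + 367 / 1600 * x ^ 6 -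
    11 / 160 * x ^ 5 * s + 237 / 800 * x ^ 5 - 37 / 160 * x ^ 4 * s + 9 / 32 * x ^ 4 -
    23 / 80 * x ^ 3 * s + 339 / 400 * x ^ 3 - 3 / 40 * x ^ 2 * s + 21 / 20 * x ^ 2 -
    7 / 200 * x * s + 49 / 200 * x + 7 / 50) * hs

lemma sin_pi_div_five_sq : Real.sin (Real.pi / 5) ^ 2 = (5 - √5) / 8 := by
  have hss : √5 ^ 2 = 5 := Real.sq_sqrt (by norm_num)
  rw [Real.sin_sq, Real.cos_pi_div_five]
  linear_combination (-1 / 16) * hss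

end

theorem corollary5p16 :
    classInvariantG 125 =
      (1 / 2 : ℝ) * ((11 + 5 * Real.sqrt 5) / 2) ^ (1 / 4 : ℝ) *
        (1 / Real.sqrt 5 *
            (1 + (2 * (1 + Real.tan (Real.pi / 5)) / (1 - Real.sin (Real.pi / 5))) ^ (1 / 5 : ℝ)
              + (2 * (1 - Real.tan (Real.pi / 5)) / (1 + Real.sin (Real.pi / 5))) ^ (1 / 5 : ℝ)) ^ 2
          - 1) := by
  have hss : √5 ^ 2 = 5 := Real.sq_sqrt (by norm_num)
  have hs2 : 2 < √5 := by
    rw [Real.lt_sqrt (by norm_num)]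
    norm_num
  have hs3 : √5 < 3 := by
    rw [Real.sqrt_lt' (by norm_num)]
    norm_num
  have hsin : 0 < Real.sin (Real.pi / 5) :=
    Real.sin_pos_of_pos_of_lt_pi (by positivity) (by linarith [Real.pi_pos])
  have hsin2 := sin_pi_div_five_sq
  have hcos := Real.cos_pi_div_five
  rw [Real.tan_eq_sin_div_cos]
  set σ := Real.sin (Real.pi / 5)
  set c := Real.cos (Real.pi / 5)
  have hc : 0 < c := by rw [hcos]; positivity
  have hc2 : c ^ 2 = 1 - σ ^ 2 := by
    rw [← Real.cos_sq']
  have hσc : σ < c := by nlinarith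
  have hσ1 : σ < 1 := by nlinarith
  have htan1 : σ / c < 1 := (div_lt_one hc).2 hσc
  have htan0 : 0 < σ / c := div_pos hsin hc
  set a := 2 * (1 + σ / c) / (1 - σ) with ha
  set b := 2 * (1 - σ / c) / (1 + σ) with hb
  have ha1 : 1 ≤ a := by
    rw [ha, le_div_iff₀ (by linarith)]
    linarith
  have hb0 : 0 < b := div_pos (by linarith) (by linarith)
  have h1σ : 1 - σ ≠ 0 := by linarith
  have h1σ' : 1 + σ ≠ 0 := by linarith
  have hsq : (1 - σ) * (1 + σ) = c ^ 2 := by rw [hc2]; ring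
  have hc2' : c ^ 2 = (3 + √5) / 8 := by
    rw [hc2, hsin2]
    ring
  have hab : a * b = (√5 - 1) ^ 5 := by
    have e1 : a * b = 4 * (c ^ 2 - σ ^ 2) / (c ^ 2 * c ^ 2) := by
      nth_rewrite 3 [← hsq]
      rw [ha, hb]
      field_simp
      ring
    have e2 : (√5 - 1) ^ 4 * (3 + √5) ^ 2 = 64 := by
      linear_combination (√5 ^ 4 + 2 * √5 ^ 3 - 4 * √5 ^ 2 + 6 * √5 + 11) * hss
    rw [e1, hsin2, hc2', div_eq_iff (by positivity)]
    linear_combination (-(√5 - 1) / 64) * e2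
  have hab' : a + b = 20 * √5 - 36 := by
    have e1 : a + b = 4 * (c + σ ^ 2) / (c * c ^ 2) := by
      rw [← hsq, ha, hb]
      field_simp
      ring
    rw [e1, hsin2, hc2', hcos, div_eq_iff (by positivity)]
    linear_combination (-(5 * √5 + 11) / 8) * hss
  have hA5 : (a ^ (1 / 5 : ℝ)) ^ 5 = a := by
    rw [← Real.rpow_natCast, ← Real.rpow_mul (by linarith)]
    norm_num
  have hB5 : (b ^ (1 / 5 : ℝ)) ^ 5 = b := by
    rw [← Real.rpow_natCast, ← Real.rpow_mul hb0.le]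
    norm_num
  have hA1 : 1 ≤ a ^ (1 / 5 : ℝ) := Real.one_le_rpow ha1 (by norm_num)
  have hB0 : 0 < b ^ (1 / 5 : ℝ) := Real.rpow_pos_of_pos hb0 _
  set A := a ^ (1 / 5 : ℝ)
  set B := b ^ (1 / 5 : ℝ)
  have hAB : A * B = √5 - 1 := by
    refine (pow_left_inj₀ (by positivity) (by linarith) (show 5 ≠ 0 by norm_num)).1 ?_
    rw [mul_pow, hA5, hB5, hab]
  have hx : (A + B) ^ 5 - 5 * (√5 - 1) * (A + B) ^ 3 + 5 * (√5 - 1) ^ 2 * (A + B) =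
      20 * √5 - 36 := by
    rw [← hAB, ← hab', ← hA5, ← hB5]
    ring
  obtain ⟨w₀, hw₀⟩ : ∃ w₀, w₀ = (1 + √5) / 4 * (1 / √5 * (1 + A + B) ^ 2 - 1) := ⟨_, rfl⟩
  have hw₀' : w₀ = (5 + √5) / 20 * (1 + (A + B)) ^ 2 - (1 + √5) / 4 := by
    have : 1 / √5 = √5 / 5 := by
      field_simp
      exact hss.symm
    rw [hw₀, this]
    linear_combination (1 + A + B) ^ 2 / 20 * hss
  have hroot := quintic_radical_root hss hx rfl hw₀'
  -- From `A ≥ 1` and `B > 0`, `w₀ ≥ (5 + √5)/5 - (1 + √5)/4 > 0`.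
  have hpos : 0 < w₀ := by
    have h4 : 2 ^ 2 ≤ (1 + (A + B)) ^ 2 := pow_le_pow_left₀ zero_le_two (by linarith) 2
    have := mul_le_mul_of_nonneg_left h4 (show 0 ≤ (5 + √5) / 20 by positivity)
    rw [hw₀']
    linarith
  have hu := weberF_pos (show 0 < √5 by positivity)
  have hv := weberF_pos (show 0 < 5 * √5 by positivity)
  have hw : weberF (5 * √5) = weberF (5 * √5) / weberF √5 * weberF √5 := by field_simp
  have hww := quintic_pos_root_unique (Real.sqrt_nonneg 5) (div_pos hv hu) hpos
    (weberF_ratio_quintic hw) hroot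
  rw [hww] at hw
  have h125 : √(((125 : ℚ) : ℝ)) = 5 * √5 := by
    rw [show (((125 : ℚ) : ℝ)) = 5 ^ 2 * 5 by norm_num, Real.sqrt_mul (by norm_num),
      Real.sqrt_sq (by norm_num)]
  -- This is `φ⁵` for the golden ratio `φ`, so its fourth root is `φ · φ^{1/4}`. The factor
  -- `φ^{1/4}` comes from `u⁴ = 2φ`, and `φ/2` is the leading factor of `w₀`.
  have hφ : (11 + 5 * √5) / 2 = ((1 + √5) / 2) ^ 4 * ((1 + √5) / 2) := by
    have h2 : ((1 + √5) / 2) ^ 2 = (3 + √5) / 2 := by linear_combination hss / 4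
    rw [show ((1 + √5) / 2) ^ 4 = (((1 + √5) / 2) ^ 2) ^ 2 by ring, h2]
    linear_combination (-(√5 + 7) / 8) * hss
  have hroot4 : ∀ y : ℝ, 0 ≤ y → (y ^ 4) ^ (1 / 4 : ℝ) = y := fun y hy => by
    rw [← Real.rpow_natCast, ← Real.rpow_mul hy]
    norm_num
  have hu4 : weberF √5 = 2 ^ (1 / 4 : ℝ) * ((1 + √5) / 2) ^ (1 / 4 : ℝ) := by
    rw [← Real.mul_rpow (by norm_num) (by positivity), ← hroot4 _ hu.le, weberF_sqrt_five]
    congr 1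
    ring
  have h2 : (2 : ℝ) ^ (-(1 / 4) : ℝ) * 2 ^ (1 / 4 : ℝ) = 1 := by
    rw [← Real.rpow_add (by norm_num)]
    norm_num
  rw [classInvariantG_eq_weberF, h125, hw, hu4, hw₀, hφ, Real.mul_rpow (by positivity) (by positivity),
    hroot4 _ (by positivity)]
  linear_combination ((1 + √5) / 4 * (1 / √5 * (1 + A + B) ^ 2 - 1) *
    ((1 + √5) / 2) ^ (1 / 4 : ℝ)) * h2
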